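/- Let $\mathbb D=\{z\in\mathbb C:|z|<1\}$, let $dA$ be Lebesgue area measure on $\mathbb D$ normalized so that $|\mathbb D|=1$, and write $|E|=\int_E dA$. For $a\in\mathbb D$ and $0<r<1$ put $B(a,r)=\{z\in\mathbb D:|z-a|<r\}$ and $S(a,r)=\{z\in\mathbb D:|z-a|<r(1-|a|)\}$. A positive function $\omega\in L^1(\mathbb D,dA)$ is called an $\mathcal A_2$ weight if $$[\omega]_{\mathcal A_2}:=\sup_{a\in\mathbb D,\ 0<r<1}\frac{\int_{B(a,r)}\omega\,dA\ \int_{B(a,r)}\omega^{-1}\,dA}{|B(a,r)|^2}<\infty ,$$ and $L^2_h(\omega)$ is the space of complex-valued harmonic functions $f$ on $\mathbb D$ with $\int_{\mathbb D}|f|^2\omega\,dA<\infty$. Theorem. Let $r,\delta\in(0,1)$ and $0\le K<\infty$. There is a constant $C>0$, depending only on $r$, $\delta$ and $K$, with the following property. Let $\omega$ be an $\mathcal A_2$ weight with $[\omega]_{\mathcal A_2}\le K$, and let $G\subset\mathbb D$ be a Lebesgue measurable set such that $$|G\cap S(a,r)|\ge\delta\,|S(a,r)|\qquad\text{for all }a\in\mathbb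 D .$$ Then $$\int_{\mathbb D}|f(z)|^2\omega(z)\,dA(z)\le C\int_G|f(z)|^2\omega(z)\,dA(z)\qquad\text{for all }f\in L^2_h(\omega).$$ -/

import Mathlib

open MeasureTheory
open scoped ENNReal NNReal

noncomputable section

/-- The open unit disk in the complex plane. -/
def unitDisk : Set ℂ := Metric.ball 0 1

/-- Lebesgue area measure on the unit disk, normalized so that the disk has measure `1`. -/
def diskArea : Measure ℂ :=
  (ENNReal.ofReal Real.pi)⁻¹ • (volume : Measure ℂ).restrict unitDisk

/-- The ball `B(a, r) = {z ∈ 𝔻 : |z - a| < r}` of the space `(𝔻, d, dA)`. -/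
def diskBall (a : ℂ) (r : ℝ) : Set ℂ := {z | z ∈ unitDisk ∧ ‖z - a‖ < r}

/-- The set `S(a, r) = {z ∈ 𝔻 : |z - a| < r (1 - |a|)}`. -/
def diskS (a : ℂ) (r : ℝ) : Set ℂ := {z | z ∈ unitDisk ∧ ‖z - a‖ < r * (1 - ‖a‖)}

/-- The Muckenhoupt characteristic
`[ω] = sup_{a ∈ 𝔻, 0 < r < 1} |B(a, r)|_ω * |B(a, r)|_{ω⁻¹} / |B(a, r)| ^ 2`,
as an extended nonnegative number. -/
def a2Characteristic (ω : ℂ → ℝ) : ℝ≥0∞ :=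
  ⨆ (a : ℂ) (_ : a ∈ unitDisk) (r : ℝ) (_ : 0 < r ∧ r < 1),
    (∫⁻ z in diskBall a r, ENNReal.ofReal (ω z) ∂diskArea) *
      (∫⁻ z in diskBall a r, (ENNReal.ofReal (ω z))⁻¹ ∂diskArea) /
        (diskArea (diskBall a r)) ^ 2

/-- Muckenhoupt `A₂` weights on the disk: (almost everywhere) positive functions in `L¹(𝔻, dA)`
with finite characteristic. -/
structure IsA2Weight (ω : ℂ → ℝ) : Prop where
  pos : ∀ᵐ z ∂diskArea, 0 < ω z
  integrable : Integrable ω diskArea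
  characteristic_lt_top : a2Characteristic ω < ∞

/-- The weighted harmonic Bergman space `L²_h(ω)`: complex-valued functions that are harmonic on
the disk and satisfy `∫_𝔻 |f|² ω dA < ∞` (the values of `f` off the disk play no role). -/
def harmonicBergman (ω : ℂ → ℝ) : Set (ℂ → ℂ) :=
  {f | InnerProductSpace.HarmonicOnNhd f unitDisk ∧
    Integrable (fun z => ‖f z‖ ^ 2 * ω z) diskArea}

end

/-!
# Dominating sets for weighted harmonic Bergman spaces

Write `S(a) = S(a, R)` for a fixed `R` with `r < R < 1`, and `μ = ω dA`. The theorem follows from a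
local estimate with an arbitrarily small constant, which is then averaged over all `a`.

**Local estimate.** For every `ε > 0` there is `C` such that, for `f` harmonic on the disk,
`|f(a)|² μ(S(a)) ≤ ε ∫_{S(a)} |f|² dμ + C ∫_{G ∩ S(a)} |f|² dμ`
(`exists_sq_enorm_mul_weightedArea_le`). By the Cauchy–Schwarz inequality and the `A₂` condition on
`S(a)`, it reduces to the unweighted bound
`|f(a)| ≤ ε avg_{S(a)} |f| + C avg_{S(a)} (|f| 1_{G ∩ S(a, r)})`
(`exists_enorm_center_le_lintegral`), which is a quantitative unique continuation property. After a
rotation `f` is replaced by a real harmonic function `u`. By Chebyshev's inequality `u` is small on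
a set of positive area, hence, in polar coordinates about `a`, on a subset of positive length of
some ray (`volume_le_of_forall_ray_slice_le`). Along this ray `u` is the restriction of a
holomorphic function, bounded by the Borel–Carathéodory theorem
(`exists_holomorphic_extension_of_ray`), and a holomorphic function which is small at many separated
points of a radius is small at the centre: dividing out a Blaschke factor at each of these points
gains a factor `r < 1` each time (`exists_norm_zero_le_of_small_on_real_set`).

**Averaging.** Divide by `μ(S(a))` and integrate in `dμ(a)`. By Tonelli's theorem the averages over
Whitney disks are bounded on `L¹`, because `μ {c | z ∈ S(c)} ≤ N μ(S(a))` whenever `z ∈ S(a)`, by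
the doubling property of `A₂` weights (`IsA2Weight.lintegral_average_diskS_le`). This gives
`∫ |f|² dμ ≤ ε N ∫ |f|² dμ + C N ∫_G |f|² dμ`, and with `ε N = 1 / 2` the first term on the right is
absorbed since `∫ |f|² dμ` is finite.
-/

/-! ### Holomorphic functions that are small on part of a radius -/

/-- Quantitative unique continuation from a subset of a radius. Dividing out one Blaschke factor at
a point of the small set multiplies the value at the centre by at least `1 / r`, up to `O(η)`, while
the supremum over the disk is preserved by the maximum principle; `n` such divisions at points
separated by `s * P` give the factor `r ^ n`. -/
theorem exists_norm_zero_le_of_small_on_real_set {r s : ℝ} (hr : 0 < r) (hr1 : r < 1) (hs : 0 < s)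
    (n : ℕ) :
    ∃ C : ℝ, 0 ≤ C ∧ ∀ P : ℝ, 0 < P → ∀ U : Set ℂ, IsOpen U → Metric.closedBall 0 P ⊆ U →
      ∀ (H : ℂ → ℂ) (M η : ℝ) (A : Set ℝ), DifferentiableOn ℂ H U →
        (∀ z ∈ Metric.closedBall (0 : ℂ) P, ‖H z‖ ≤ M) → 0 ≤ η → A ⊆ Set.Icc 0 (r * P) →
        (∀ t ∈ A, ‖H (t : ℂ)‖ ≤ η) → ENNReal.ofReal (2 * s * n * P) < volume A →
        ‖H 0‖ ≤ r ^ n * M + C * η := by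
  induction n with
  | zero =>
    refine ⟨0, le_rfl, fun P hP U _ _ H M η A _ hM _ _ _ _ => ?_⟩
    simpa using hM 0 (by simp [hP.le])
  | succ n ih =>
    obtain ⟨C, hC, ih⟩ := ih
    refine ⟨1 + r ^ (n + 1) + r * (C * (2 / s)), by positivity, ?_⟩
    intro P hP U hU hPU H M η A hH hM hη hA hAη hvol
    have hne : A.Nonempty := by
      rw [Set.nonempty_iff_ne_empty]
      rintro rfl
      simp at hvol
    obtain ⟨t, htA⟩ := hne
    obtain ⟨ht0, htr⟩ := hA htA
    have htP : t < P := htr.trans_lt (by nlinarith)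
    have htn : ‖(t : ℂ)‖ = t := by simp [abs_of_nonneg ht0]
    have hPC : (P : ℂ) ≠ 0 := by exact_mod_cast hP.ne'
    -- The difference quotient times the inverse of a Blaschke factor of the disk of radius `P`.
    obtain ⟨H₁, hH₁_def⟩ : ∃ H₁ : ℂ → ℂ, H₁ = fun z => dslope H t z * (((P : ℂ) ^ 2 - t * z) / P) :=
      ⟨_, rfl⟩
    have htU : U ∈ nhds (t : ℂ) := hU.mem_nhds (hPU (by simp [abs_of_nonneg ht0, htP.le]))
    have hd : DifferentiableOn ℂ (dslope H t) U := (Complex.differentiableOn_dslope htU).2 hH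
    have hH₁ : DifferentiableOn ℂ H₁ U := by
      rw [hH₁_def]
      refine hd.mul (Differentiable.differentiableOn ?_)
      fun_prop
    have hkey : ∀ z : ℂ, (z - t) * H₁ z = (H z - H t) * (((P : ℂ) ^ 2 - t * z) / P) := by
      intro z
      have := sub_smul_dslope H (t : ℂ) z
      rw [smul_eq_mul] at this
      rw [← this, hH₁_def]; ring
    have hsphere : ∀ z ∈ Metric.sphere (0 : ℂ) P, ‖H₁ z‖ ≤ M + η := by
      intro z hz
      have hzP : ‖z‖ = P := by simpa using hz
      have hzt : 0 < ‖z - t‖ := by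
        have := norm_sub_norm_le z t
        rw [hzP, htn] at this; linarith
      have h1 : ‖(P : ℂ) ^ 2 - t * z‖ = P * ‖z - t‖ := by
        have h2 : (P : ℂ) ^ 2 = (starRingEnd ℂ) z * z := by
          rw [← hzP, mul_comm, Complex.mul_conj, Complex.normSq_eq_norm_sq]; push_cast; ring
        have h3 : (P : ℂ) ^ 2 - t * z = z * (starRingEnd ℂ) (z - t) := by
          rw [h2, map_sub, Complex.conj_ofReal]; ring
        rw [h3, norm_mul, hzP, RCLike.norm_conj]
      have h4 := congrArg norm (hkey z)
      rw [norm_mul, norm_mul, norm_div, h1, Complex.norm_real, Real.norm_of_nonneg hP.le,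
        mul_div_cancel_left₀ _ hP.ne', mul_comm] at h4
      rw [mul_right_cancel₀ hzt.ne' h4]
      exact (norm_sub_le _ _).trans (add_le_add (hM z (by simp [hzP])) (hAη t htA))
    have hbd : ∀ z ∈ Metric.closedBall (0 : ℂ) P, ‖H₁ z‖ ≤ M + η := by
      intro z hz
      refine Complex.norm_le_of_forall_mem_frontier_norm_le (U := Metric.ball 0 P)
        Metric.isBounded_ball ?_ ?_ (by rwa [closure_ball _ hP.ne'])
      · exact (hH₁.mono hPU).diffContOnCl_ball subset_rfl
      · intro w hw
        rw [frontier_ball _ hP.ne'] at hw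
        exact hsphere w hw
    have hA' : ∀ t' ∈ A \ Metric.ball t (s * P), ‖H₁ (t' : ℂ)‖ ≤ 2 / s * η := by
      rintro t' ⟨ht', hfar⟩
      obtain ⟨h0, h1⟩ := hA ht'
      have hdist : s * P ≤ |t' - t| := by simpa [Real.dist_eq] using hfar
      have h4 := congrArg norm (hkey (t' : ℂ))
      have h5 : (t' : ℂ) - t = ((t' - t : ℝ) : ℂ) := by push_cast; ring
      have h6 : ((P : ℂ) ^ 2 - t * t') / P = (((P ^ 2 - t * t') / P : ℝ) : ℂ) := by push_cast; ring
      rw [norm_mul, norm_mul, h5, h6, Complex.norm_real, Complex.norm_real, Real.norm_eq_abs,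
        Real.norm_eq_abs] at h4
      have h7 : |(P ^ 2 - t * t') / P| ≤ P := by
        have : t' < P := h1.trans_lt (by nlinarith)
        rw [abs_of_nonneg (div_nonneg (by nlinarith) hP.le), div_le_iff₀ hP]
        nlinarith [mul_nonneg ht0 h0]
      have h8 : ‖H t' - H t‖ ≤ 2 * η := by
        have := norm_sub_le (H t') (H t)
        linarith [hAη t htA, hAη t' ht']
      have h9 : s * P * ‖H₁ t'‖ ≤ 2 * η * P := by
        calc s * P * ‖H₁ t'‖ ≤ |t' - t| * ‖H₁ t'‖ := by gcongr
          _ = _ := h4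
          _ ≤ 2 * η * P := by gcongr
      have h10 : s * ‖H₁ t'‖ ≤ 2 * η := by
        refine le_of_mul_le_mul_right ?_ hP
        linarith
      rw [div_mul_eq_mul_div, le_div_iff₀ hs]
      linarith
    have hvol' : ENNReal.ofReal (2 * s * n * P) < volume (A \ Metric.ball t (s * P)) := by
      have h1 := le_measure_sdiff (μ := (volume : Measure ℝ)) (s₁ := A) (s₂ := Metric.ball t (s * P))
      refine lt_of_lt_of_le ?_ h1
      rw [Real.volume_ball]
      refine lt_tsub_iff_right.2 ?_
      rw [← ENNReal.ofReal_add (by positivity) (by positivity)]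
      refine lt_of_eq_of_lt ?_ hvol
      congr 1; push_cast; ring
    have h0 := ih P hP U hU hPU H₁ (M + η) (2 / s * η) _ hH₁ hbd (by positivity)
      (Set.sdiff_subset.trans hA) hA' hvol'
    have h1 : ‖H 0‖ ≤ η + r * ‖H₁ 0‖ := by
      have h2 : H 0 = H t - t / P * H₁ 0 := by
        have := hkey 0
        rw [zero_sub, mul_zero, sub_zero, sq, mul_div_cancel_right₀ _ hPC] at this
        field_simp
        linear_combination -this
      rw [h2]
      refine (norm_sub_le _ _).trans (add_le_add (hAη t htA) ?_)
      rw [norm_mul, norm_div, htn, Complex.norm_real, Real.norm_of_nonneg hP.le]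
      gcongr
      rwa [div_le_iff₀ hP]
    calc ‖H 0‖ ≤ η + r * ‖H₁ 0‖ := h1
      _ ≤ η + r * (r ^ n * (M + η) + C * (2 / s * η)) := by gcongr
      _ = _ := by ring

/-! ### Area and mean values in polar coordinates -/

/-- A planar set inside a disk has small area if all its slices by rays from the centre are
short. -/
theorem volume_le_of_forall_ray_slice_le {a : ℂ} {T : ℝ} {E : Set ℂ}
    (hE : MeasurableSet E) (hET : E ⊆ Metric.ball a T) {x : ℝ≥0∞}
    (hx : ∀ θ : ℝ, volume {t : ℝ | 0 < t ∧ a + Complex.polarCoord.symm (t, θ) ∈ E} ≤ x) :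
    volume E ≤ ENNReal.ofReal (2 * Real.pi * T) * x := by
  have hpm : Measurable fun p : ℝ × ℝ => a + Complex.polarCoord.symm p := by
    simp only [Complex.polarCoord_symm_apply]; fun_prop
  have hm : MeasurableSet {p : ℝ × ℝ | 0 < p.1 ∧ a + Complex.polarCoord.symm p ∈ E} :=
    (measurableSet_lt measurable_const measurable_fst).inter (hpm hE)
  have h1 : volume E = volume ((a + ·) ⁻¹' E) := (measure_preimage_add _ _ _).symm
  have hE' : MeasurableSet ((a + ·) ⁻¹' E) := (measurable_const_add a) hE
  rw [h1, ← lintegral_indicator_one hE', ← Complex.lintegral_comp_polarCoord_symm]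
  calc _ ≤ ∫⁻ p in Set.univ ×ˢ Set.Ioo (-Real.pi) Real.pi,
          ({p : ℝ × ℝ | 0 < p.1 ∧ a + Complex.polarCoord.symm p ∈ E}).indicator
            (fun _ => ENNReal.ofReal T) p := by
        have hsub : polarCoord.target ⊆ Set.univ ×ˢ Set.Ioo (-Real.pi) Real.pi :=
          fun p hp => ⟨trivial, hp.2⟩
        suffices hpt : ∀ p ∈ polarCoord.target,
            ENNReal.ofReal p.1 • ((a + ·) ⁻¹' E).indicator 1 (Complex.polarCoord.symm p) ≤
              ({p : ℝ × ℝ | 0 < p.1 ∧ a + Complex.polarCoord.symm p ∈ E}).indicator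
                (fun _ => ENNReal.ofReal T) p by
          exact (setLIntegral_mono_ae' polarCoord.open_target.measurableSet
            (Filter.Eventually.of_forall hpt)).trans (lintegral_mono_set hsub)
        intro p hp
        classical
        rw [Set.indicator_apply, Set.indicator_apply]
        simp only [Set.mem_preimage, Set.mem_ofPred_eq, Pi.one_apply]
        by_cases h : a + Complex.polarCoord.symm p ∈ E
        · have hp0 : 0 < p.1 := hp.1
          have h2 : |p.1| < T := by
            rw [← Complex.norm_polarCoord_symm]
            simpa [dist_eq_norm] using hET h
          rw [if_pos h, if_pos ⟨hp0, h⟩]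
          simpa using ENNReal.ofReal_le_ofReal ((le_abs_self _).trans h2.le)
        · rw [if_neg h, smul_zero]
          exact zero_le
    _ = ∫⁻ θ in Set.Ioo (-Real.pi) Real.pi, ENNReal.ofReal T *
          volume {t : ℝ | 0 < t ∧ a + Complex.polarCoord.symm (t, θ) ∈ E} := by
        rw [Measure.volume_eq_prod, ← Measure.prod_restrict, lintegral_prod_symm _
          ((measurable_const.indicator hm).aemeasurable)]
        refine lintegral_congr fun θ => ?_
        rw [Measure.restrict_univ]
        have hmθ : MeasurableSet {t : ℝ | 0 < t ∧ a + Complex.polarCoord.symm (t, θ) ∈ E} :=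
          measurable_prodMk_right hm
        rw [← lintegral_indicator_const hmθ]
        rfl
    _ ≤ ∫⁻ θ in Set.Ioo (-Real.pi) Real.pi, ENNReal.ofReal T * x := by
        gcongr with θ
        exact hx θ
    _ = _ := by
        rw [setLIntegral_const, Real.volume_Ioo, sub_neg_eq_add, ← two_mul,
          ENNReal.ofReal_mul (p := 2 * Real.pi) (by positivity)]
        ring

open InnerProductSpace in
theorem enorm_le_lintegral_circle_of_harmonic {f : ℂ → ℂ} {w : ℂ} {d t : ℝ}
    (hf : HarmonicOnNhd f (Metric.ball w d)) (ht : 0 < t) (htd : t < d) :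
    ENNReal.ofReal (2 * Real.pi) * ‖f w‖ₑ ≤
      ∫⁻ θ in Set.Ioo (-Real.pi) Real.pi, ‖f (w + Complex.polarCoord.symm (t, θ))‖ₑ := by
  have hav := InnerProductSpace.HarmonicOnNhd.circleAverage_eq (f := f) (c := w) (R := t)
    (hf.mono (Metric.closedBall_subset_ball (by rwa [abs_of_pos ht])))
  rw [Real.circleAverage_eq_integral_add (-Real.pi), intervalIntegral.integral_comp_add_right
    (fun θ => f (circleMap w t θ)), zero_add,
    show 2 * Real.pi + -Real.pi = Real.pi by ring] at hav
  have h2 : (2 * Real.pi) • f w = ∫ θ in (-Real.pi)..Real.pi, f (circleMap w t θ) := by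
    rw [← hav, smul_smul, mul_inv_cancel₀ (by positivity), one_smul]
  rw [intervalIntegral.integral_of_le (by linarith [Real.pi_pos]),
    integral_Ioc_eq_integral_Ioo] at h2
  calc ENNReal.ofReal (2 * Real.pi) * ‖f w‖ₑ = ‖(2 * Real.pi) • f w‖ₑ := by
        rw [enorm_smul, Real.enorm_of_nonneg (by positivity)]
    _ ≤ ∫⁻ θ in Set.Ioo (-Real.pi) Real.pi, ‖f (circleMap w t θ)‖ₑ := by
        rw [h2]; exact enorm_integral_le_lintegral_enorm _
    _ = _ := by
        refine lintegral_congr fun θ => ?_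
        rw [circleMap, Complex.polarCoord_symm_apply, Complex.exp_mul_I]
        simp

open InnerProductSpace in
/-- The sub-mean value property of `‖f‖` over disks. -/
theorem mul_enorm_le_lintegral_ball_of_harmonic {f : ℂ → ℂ} {w : ℂ} {d : ℝ} (hd : 0 < d)
    (hf : HarmonicOnNhd f (Metric.ball w d)) :
    ENNReal.ofReal (Real.pi * d ^ 2) * ‖f w‖ₑ ≤ ∫⁻ z in Metric.ball w d, ‖f z‖ₑ := by
  classical
  set g : ℂ → ℝ≥0∞ := (Metric.ball w d).indicator fun z => ‖f z‖ₑ with hg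
  have hgm : Measurable g := by
    rw [hg, ← Set.piecewise_eq_indicator]
    exact ContinuousOn.measurable_piecewise hf.continuousOn.enorm continuousOn_const
      measurableSet_ball
  have hpm : Measurable fun p : ℝ × ℝ => w + Complex.polarCoord.symm p := by
    simp only [Complex.polarCoord_symm_apply]; fun_prop
  have hint : ∫⁻ t in Set.Ioo 0 d, ENNReal.ofReal t = ENNReal.ofReal (d ^ 2 / 2) := by
    rw [← ofReal_integral_eq_lintegral_ofReal, ← integral_Ioc_eq_integral_Ioo,
      ← intervalIntegral.integral_of_le hd.le, integral_id]
    · simp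
    · exact continuous_id.integrableOn_Ioc.mono_set Set.Ioo_subset_Ioc_self
    · exact (ae_restrict_iff' measurableSet_Ioo).2 (Filter.Eventually.of_forall fun t ht => ht.1.le)
  calc ENNReal.ofReal (Real.pi * d ^ 2) * ‖f w‖ₑ
      = ∫⁻ t in Set.Ioo 0 d, ENNReal.ofReal t * (ENNReal.ofReal (2 * Real.pi) * ‖f w‖ₑ) := by
        rw [lintegral_mul_const _ ENNReal.measurable_ofReal, hint, ← mul_assoc,
          ← ENNReal.ofReal_mul (by positivity)]
        congr 2; ring
    _ ≤ ∫⁻ t in Set.Ioo 0 d, ENNReal.ofReal t *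
          ∫⁻ θ in Set.Ioo (-Real.pi) Real.pi, g (w + Complex.polarCoord.symm (t, θ)) := by
        refine setLIntegral_mono_ae' measurableSet_Ioo (Filter.Eventually.of_forall fun t ht => ?_)
        gcongr
        refine (enorm_le_lintegral_circle_of_harmonic hf ht.1 ht.2).trans_eq ?_
        refine lintegral_congr fun θ => ?_
        rw [hg, Set.indicator_of_mem]
        rw [Metric.mem_ball, dist_eq_norm, add_sub_cancel_left, Complex.norm_polarCoord_symm]
        simpa [abs_of_pos ht.1] using ht.2
    _ = ∫⁻ p in Set.Ioo 0 d ×ˢ Set.Ioo (-Real.pi) Real.pi,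
          ENNReal.ofReal p.1 * g (w + Complex.polarCoord.symm p) := by
        rw [Measure.volume_eq_prod, ← Measure.prod_restrict, lintegral_prod]
        · refine lintegral_congr fun t => ?_
          exact (lintegral_const_mul _ ((hgm.comp hpm).comp measurable_prodMk_left)).symm
        · exact ((ENNReal.measurable_ofReal.comp measurable_fst).mul (hgm.comp hpm)).aemeasurable
    _ ≤ ∫⁻ p in polarCoord.target, ENNReal.ofReal p.1 • g (w + Complex.polarCoord.symm p) :=
        lintegral_mono_set fun p hp => ⟨hp.1.1, hp.2⟩
    _ = ∫⁻ z, g (w + z) := Complex.lintegral_comp_polarCoord_symm fun z => g (w + z)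
    _ = ∫⁻ z, g z := lintegral_add_left_eq_self g w
    _ = _ := lintegral_indicator measurableSet_ball _

/-! ### Unique continuation for harmonic functions from sets of positive area -/

open InnerProductSpace in
/-- A real harmonic function which is bounded on a disk is, along any ray from the centre, the
restriction of a holomorphic function with comparable bounds on smaller disks. -/
theorem exists_holomorphic_extension_of_ray {u : ℂ → ℝ} {a e : ℂ} {Q M : ℝ} (he : ‖e‖ = 1)
    (hQ : 0 < Q) (hM : 0 < M) (hu : HarmonicOnNhd u (Metric.ball a Q))
    (huM : ∀ z ∈ Metric.ball a Q, |u z| ≤ M) :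
    ∃ H : ℂ → ℂ, DifferentiableOn ℂ H (Metric.ball 0 Q) ∧
      (∀ t : ℝ, |t| < Q → H t = u (a + t * e)) ∧
      ∀ P < Q, ∀ z ∈ Metric.closedBall (0 : ℂ) P, ‖H z‖ ≤ M * ((3 * P + Q) / (Q - P)) := by
  obtain ⟨F, hF, hFu⟩ := hu.exists_analyticOnNhd_ball_re_eq
  have hmem : ∀ z ∈ Metric.ball (0 : ℂ) Q, a + z * e ∈ Metric.ball a Q := by
    intro z hz
    simpa [he] using hz
  obtain ⟨G, hG⟩ : ∃ G : ℂ → ℂ, G = fun z => F (a + z * e) - (F a).im * Complex.I := ⟨_, rfl⟩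
  have hGd : DifferentiableOn ℂ G (Metric.ball 0 Q) := by
    rw [hG]
    refine DifferentiableOn.sub_const ?_ _
    exact hF.differentiableOn.comp (by fun_prop) hmem
  have hGre : ∀ z ∈ Metric.ball (0 : ℂ) Q, (G z).re = u (a + z * e) := by
    intro z hz
    rw [hG, ← hFu (hmem z hz)]
    simp
  have hG0 : ‖G 0‖ ≤ M := by
    have h0 : (0 : ℂ) ∈ Metric.ball (0 : ℂ) Q := by simpa using hQ
    have h1 : G 0 = ((u a : ℝ) : ℂ) := by
      apply Complex.ext
      · rw [hGre 0 h0]; simp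
      · simp [hG]
    rw [h1, Complex.norm_real]
    exact huM a (Metric.mem_ball_self hQ)
  have hGb : ∀ P < Q, ∀ z ∈ Metric.closedBall (0 : ℂ) P, ‖G z‖ ≤ M * ((3 * P + Q) / (Q - P)) := by
    intro P hP z hz
    have hzP : ‖z‖ ≤ P := by simpa using hz
    have hzQ : z ∈ Metric.ball (0 : ℂ) Q := by simpa using hzP.trans_lt hP
    have h1 := Complex.borelCaratheodory hM hGd (fun z hz => by
      show (G z).re ≤ M
      rw [hGre z hz]
      exact (le_abs_self _).trans (huM _ (hmem z hz))) hQ hzQ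
    have hQz : Q - P ≤ Q - ‖z‖ := by linarith
    have hQP : 0 < Q - P := by linarith
    have hP0 : 0 ≤ P := (norm_nonneg z).trans hzP
    calc ‖G z‖ ≤ _ := h1
      _ ≤ 2 * M * P / (Q - P) + M * (Q + P) / (Q - P) := by gcongr
      _ = _ := by field_simp; ring
  refine ⟨fun z => (G z + (starRingEnd ℂ) (G ((starRingEnd ℂ) z))) / 2, ?_, ?_, ?_⟩
  · intro z hz
    have hcz : (starRingEnd ℂ) z ∈ Metric.ball (0 : ℂ) Q := by simpa using hz
    have h1 : DifferentiableAt ℂ G z := hGd.differentiableAt (Metric.isOpen_ball.mem_nhds hz)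
    have h2 : DifferentiableAt ℂ G ((starRingEnd ℂ) z) :=
      hGd.differentiableAt (Metric.isOpen_ball.mem_nhds hcz)
    have h3 := h2.conj_conj
    rw [Complex.conj_conj] at h3
    exact ((h1.add h3).div_const 2).differentiableWithinAt
  · intro t ht
    have htQ : (t : ℂ) ∈ Metric.ball (0 : ℂ) Q := by simpa using ht
    beta_reduce
    rw [Complex.conj_ofReal, Complex.add_conj, ← hGre t htQ]
    push_cast; ring
  · intro P hP z hz
    have hcz : (starRingEnd ℂ) z ∈ Metric.closedBall (0 : ℂ) P := by simpa using hz
    have h1 := hGb P hP z hz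
    have h2 := hGb P hP _ hcz
    rw [norm_div, Complex.norm_ofNat, div_le_iff₀ two_pos]
    refine (norm_add_le _ _).trans ?_
    rw [RCLike.norm_conj]
    linarith

open InnerProductSpace in
/-- Quantitative unique continuation for harmonic functions from a set of positive area: the factor
`ε` in front of the a priori bound is arbitrarily small. -/
theorem exists_norm_center_le_of_small_on {r δ ε : ℝ} (hr : 0 < r) (hr1 : r < 1) (hδ : 0 < δ)
    (hε : 0 < ε) :
    ∃ C : ℝ, 0 ≤ C ∧ ∀ (f : ℂ → ℂ) (a : ℂ) (Q M η : ℝ) (E : Set ℂ), 0 < Q →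
      HarmonicOnNhd f (Metric.ball a Q) → (∀ z ∈ Metric.ball a Q, ‖f z‖ ≤ M) → 0 ≤ η →
      MeasurableSet E → E ⊆ Metric.ball a (r * Q) → ENNReal.ofReal (δ * Q ^ 2) ≤ volume E →
      (∀ z ∈ E, ‖f z‖ ≤ η) → ‖f a‖ ≤ ε * M + C * η := by
  set p : ℝ := (1 + r) / 2 with hp
  have hp0 : 0 < p := by rw [hp]; linarith
  have hp1 : p < 1 := by rw [hp]; linarith
  have hrp : r < p := by rw [hp]; linarith
  -- `L` is the Borel–Carathéodory constant for the radii `p * Q < Q`.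
  set L : ℝ := (3 * p + 1) / (1 - p) with hL
  have hL0 : 0 < L := div_pos (by linarith) (by linarith)
  have hrp1 : r / p < 1 := (div_lt_one hp0).2 hrp
  obtain ⟨n, hn⟩ := exists_pow_lt_of_lt_one (div_pos hε hL0) hrp1
  set s : ℝ := δ / (8 * Real.pi * (n + 1)) with hs
  have hs0 : 0 < s := by positivity
  obtain ⟨C, hC, hmain⟩ := exists_norm_zero_le_of_small_on_real_set (div_pos hr hp0) hrp1 hs0 n
  -- With this `s`, a set of area at least `δ * Q ^ 2` has a radial slice longer than
  -- `2 * s * n * (p * Q)`.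
  refine ⟨C, hC, ?_⟩
  intro f a Q M η E hQ hf hfM hη hE hEQ hvol hfE
  have haQ : a ∈ Metric.ball a Q := Metric.mem_ball_self hQ
  rcases eq_or_ne (f a) 0 with hfa | hfa
  · rw [hfa, norm_zero]
    have := (norm_nonneg _).trans (hfM a haQ)
    positivity
  have hfa' : 0 < ‖f a‖ := norm_pos_iff.2 hfa
  have hM : 0 < M := hfa'.trans_le (hfM a haQ)
  -- Rotating `f a` onto the positive axis and taking real parts reduces to a real function.
  obtain ⟨c, hc, hcf⟩ : ∃ c : ℂ, ‖c‖ = 1 ∧ c * f a = ‖f a‖ := by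
    refine ⟨(starRingEnd ℂ) (f a) / ‖f a‖, by simp [hfa], ?_⟩
    rw [div_mul_eq_mul_div, mul_comm, Complex.mul_conj, Complex.normSq_eq_norm_sq]
    have : (‖f a‖ : ℂ) ≠ 0 := by exact_mod_cast hfa'.ne'
    push_cast
    field_simp
  obtain ⟨u, hu_def⟩ : ∃ u : ℂ → ℝ, u = fun z => (c * f z).re := ⟨_, rfl⟩
  have hu : HarmonicOnNhd u (Metric.ball a Q) := by
    rw [hu_def]
    exact hf.comp_CLM (Complex.reCLM ∘L (ContinuousLinearMap.mul ℝ ℂ c))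
  have huf : ∀ z, |u z| ≤ ‖f z‖ := by
    intro z
    rw [hu_def]
    exact (Complex.abs_re_le_norm _).trans (by rw [norm_mul, hc, one_mul])
  have hua : u a = ‖f a‖ := by rw [hu_def]; simp [hcf]
  obtain ⟨θ, hθ⟩ : ∃ θ : ℝ, ENNReal.ofReal (2 * s * n * (p * Q)) <
      volume {t : ℝ | 0 < t ∧ a + Complex.polarCoord.symm (t, θ) ∈ E} := by
    by_contra! hcon
    have h1 := hvol.trans (volume_le_of_forall_ray_slice_le hE hEQ hcon)
    rw [← ENNReal.ofReal_mul (by positivity), ENNReal.ofReal_le_ofReal_iff (by positivity)] at h1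
    have h2 : 2 * Real.pi * (r * Q) * (2 * s * n * (p * Q)) =
        (δ * Q ^ 2) * ((n / (n + 1)) * (r * p) / 2) := by
      rw [hs]; field_simp; ring
    rw [h2] at h1
    have h3 : (n : ℝ) / (n + 1) ≤ 1 := (div_le_one (by positivity)).2 (by linarith)
    have h4 : r * p ≤ 1 := by nlinarith
    have h5 : (n : ℝ) / (n + 1) * (r * p) ≤ 1 := mul_le_one₀ h3 (by positivity) h4
    have h6 : 0 < δ * Q ^ 2 := by positivity
    nlinarith
  obtain ⟨H, hHd, hHu, hHb⟩ := exists_holomorphic_extension_of_ray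
    (e := Real.cos θ + Real.sin θ * Complex.I)
    (by rw [Complex.norm_add_mul_I, Real.cos_sq_add_sin_sq, Real.sqrt_one]) hQ hM hu
    (fun z hz => (huf z).trans (hfM z hz))
  have hpQ : p * Q < Q := by nlinarith
  have hLM : ∀ z ∈ Metric.closedBall (0 : ℂ) (p * Q), ‖H z‖ ≤ M * L := by
    intro z hz
    refine (hHb _ hpQ z hz).trans_eq ?_
    have : 1 - p ≠ 0 := by linarith
    have : Q - p * Q ≠ 0 := by linarith
    rw [hL]
    field_simp
  have hA : ∀ t ∈ {t : ℝ | 0 < t ∧ a + Complex.polarCoord.symm (t, θ) ∈ E}, t < r * Q := by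
    rintro t ⟨ht, htE⟩
    have := hEQ htE
    rw [Metric.mem_ball, dist_eq_norm, add_sub_cancel_left, Complex.norm_polarCoord_symm] at this
    exact (le_abs_self _).trans_lt this
  have h := hmain (p * Q) (by positivity) _ Metric.isOpen_ball
    (Metric.closedBall_subset_ball hpQ) H (M * L) η _ hHd hLM hη
    (fun t ht => ⟨ht.1.le, (hA t ht).le.trans_eq (by field_simp)⟩) (fun t ht => by
      have ht1 := hA t ht
      rw [hHu t (by rw [abs_of_pos ht.1]; nlinarith), Complex.norm_real]
      refine (huf _).trans ?_
      have := hfE _ ht.2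
      rwa [Complex.polarCoord_symm_apply] at this) hθ
  have h0 := hHu 0 (by simpa using hQ)
  simp only [Complex.ofReal_zero, zero_mul, add_zero] at h0
  rw [h0, hua, Complex.norm_real, norm_norm] at h
  rw [lt_div_iff₀ hL0] at hn
  calc ‖f a‖ ≤ _ := h
    _ = (r / p) ^ n * L * M + C * η := by ring
    _ ≤ ε * M + C * η := by gcongr

open InnerProductSpace in
/-- The integrated form of `exists_norm_center_le_of_small_on`: the bound on `‖f‖` over a smaller
disk comes from the sub-mean value property. -/
theorem exists_enorm_center_le_lintegral {r δ ε : ℝ} (hr : 0 < r) (hr1 : r < 1) (hδ : 0 < δ)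
    (hε : 0 < ε) :
    ∃ C : ℝ, 0 ≤ C ∧ ∀ (f : ℂ → ℂ) (a : ℂ) (ρ : ℝ) (E : Set ℂ), 0 < ρ →
      HarmonicOnNhd f (Metric.ball a ρ) → MeasurableSet E → E ⊆ Metric.ball a (r * ρ) →
      ENNReal.ofReal (δ * ρ ^ 2) ≤ volume E →
      ENNReal.ofReal (ρ ^ 2) * ‖f a‖ₑ ≤
        ENNReal.ofReal ε * (∫⁻ z in Metric.ball a ρ, ‖f z‖ₑ) +
          ENNReal.ofReal C * ∫⁻ z in E, ‖f z‖ₑ := by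
  set q : ℝ := (1 + r) / 2 with hq
  have hq0 : 0 < q := by rw [hq]; linarith
  have hq1 : 0 < 1 - q := by rw [hq]; linarith
  have hrq : r < q := by rw [hq]; linarith
  obtain ⟨C, hC, hmain⟩ := exists_norm_center_le_of_small_on (r := r / q) (δ := δ / (2 * q ^ 2))
    (ε := ε * (Real.pi * (1 - q) ^ 2)) (by positivity) ((div_lt_one hq0).2 hrq) (by positivity)
    (by positivity)
  refine ⟨C * (2 / δ), by positivity, ?_⟩
  intro f a ρ E hρ hf hE hEr hvol
  set I := ∫⁻ z in Metric.ball a ρ, ‖f z‖ₑ with hI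
  set J := ∫⁻ z in E, ‖f z‖ₑ with hJ
  rcases eq_or_ne I ⊤ with hIt | hIt
  · rw [hIt, ENNReal.mul_top (by simpa using hε), top_add]
    exact le_top
  have hEb : E ⊆ Metric.ball a ρ :=
    hEr.trans (Metric.ball_subset_ball (by nlinarith))
  have hJt : J ≠ ⊤ := ne_top_of_le_ne_top hIt (lintegral_mono_set hEb)
  have hM : ∀ z ∈ Metric.ball a (q * ρ), ‖f z‖ ≤ I.toReal / (Real.pi * ((1 - q) * ρ) ^ 2) := by
    intro z hz
    have hsub : Metric.ball z ((1 - q) * ρ) ⊆ Metric.ball a ρ := by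
      refine Metric.ball_subset_ball' ?_
      have := Metric.mem_ball.1 hz
      linarith
    have h1 := (mul_enorm_le_lintegral_ball_of_harmonic (by positivity) (hf.mono hsub)).trans
      (lintegral_mono_set hsub)
    have h2 := ENNReal.toReal_mono hIt h1
    rw [ENNReal.toReal_mul, ENNReal.toReal_ofReal (by positivity), toReal_enorm] at h2
    rw [le_div_iff₀ (by positivity), mul_comm]
    exact h2
  have hτ : ∀ τ : ℝ, 0 < τ → ‖f a‖ ≤ ε * (Real.pi * (1 - q) ^ 2) *
      (I.toReal / (Real.pi * ((1 - q) * ρ) ^ 2)) + C * (2 * J.toReal / (δ * ρ ^ 2) + τ) := by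
    intro τ hτ
    set η := 2 * J.toReal / (δ * ρ ^ 2) + τ with hη
    have hη0 : 0 < η := by positivity
    set V := Metric.ball a ρ ∩ (fun z => ‖f z‖) ⁻¹' Set.Ioi η with hV
    have hVo : IsOpen V := hf.continuousOn.norm.isOpen_inter_preimage Metric.isOpen_ball isOpen_Ioi
    -- By Chebyshev's inequality, `f` is small on at least half of `E`.
    have hEV : volume (E ∩ V) ≤ ENNReal.ofReal (δ * ρ ^ 2 / 2) := by
      have h1 : ENNReal.ofReal η * volume (E ∩ V) ≤ J := by
        calc ENNReal.ofReal η * volume (E ∩ V) = ∫⁻ z in E ∩ V, ENNReal.ofReal η := by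
              rw [setLIntegral_const]
          _ ≤ ∫⁻ z in E ∩ V, ‖f z‖ₑ := by
              refine setLIntegral_mono_ae' (hE.inter hVo.measurableSet)
                (Filter.Eventually.of_forall fun z hz => ?_)
              rw [← ofReal_norm]
              exact ENNReal.ofReal_le_ofReal (le_of_lt hz.2.2)
          _ ≤ J := lintegral_mono_set Set.inter_subset_left
      have h2 : J ≤ ENNReal.ofReal η * ENNReal.ofReal (δ * ρ ^ 2 / 2) := by
        rw [← ENNReal.ofReal_mul hη0.le, ← ENNReal.ofReal_toReal hJt]
        refine ENNReal.ofReal_le_ofReal ?_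
        have h3 : η * (δ * ρ ^ 2 / 2) = J.toReal + τ * (δ * ρ ^ 2 / 2) := by
          rw [hη]; field_simp
        rw [h3]
        have : 0 < τ * (δ * ρ ^ 2 / 2) := by positivity
        linarith
      exact (ENNReal.mul_le_mul_iff_right (by simpa using hη0) ENNReal.ofReal_ne_top).1 (h1.trans h2)
    have hvol' : ENNReal.ofReal (δ / (2 * q ^ 2) * (q * ρ) ^ 2) ≤ volume (E \ V) := by
      rw [← Set.sdiff_self_inter]
      refine le_trans ?_ (le_measure_sdiff (μ := (volume : Measure ℂ)))
      refine le_trans ?_ (tsub_le_tsub hvol hEV)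
      rw [← ENNReal.ofReal_sub _ (by positivity)]
      refine ENNReal.ofReal_le_ofReal (le_of_eq ?_)
      field_simp; ring
    refine hmain f a (q * ρ) _ η (E \ V) (by positivity)
      (hf.mono (Metric.ball_subset_ball (by nlinarith))) hM hη0.le (hE.diff hVo.measurableSet)
      (Set.sdiff_subset.trans (hEr.trans_eq ?_)) hvol' ?_
    · congr 1; field_simp
    · rintro z ⟨hzE, hzV⟩
      by_contra! hlt
      exact hzV ⟨hEb hzE, hlt⟩
  -- The slack `τ` keeps `η` positive even when `f` vanishes a.e. on `E`; it now tends to zero.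
  have hlim : ‖f a‖ ≤ ε * (Real.pi * (1 - q) ^ 2) *
      (I.toReal / (Real.pi * ((1 - q) * ρ) ^ 2)) + C * (2 * J.toReal / (δ * ρ ^ 2)) := by
    refine le_of_forall_pos_le_add fun τ hτ0 => ?_
    have h1 := hτ (τ / (C + 1)) (by positivity)
    have h2 : C * (τ / (C + 1)) ≤ τ := by
      rw [← mul_div_assoc, div_le_iff₀ (by positivity)]
      nlinarith
    linarith
  have hfin : ρ ^ 2 * ‖f a‖ ≤ ε * I.toReal + C * (2 / δ) * J.toReal := by
    calc ρ ^ 2 * ‖f a‖ ≤ _ := mul_le_mul_of_nonneg_left hlim (by positivity)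
      _ = _ := by field_simp
  rw [← ofReal_norm, ← ENNReal.ofReal_mul (by positivity), ← ENNReal.ofReal_toReal hIt,
    ← ENNReal.ofReal_toReal hJt, ← ENNReal.ofReal_mul hε.le, ← ENNReal.ofReal_mul (by positivity),
    ← ENNReal.ofReal_add (by positivity) (by positivity)]
  exact ENNReal.ofReal_le_ofReal hfin

/-! ### Area of balls and Whitney disks -/

theorem measurableSet_unitDisk : MeasurableSet unitDisk := measurableSet_ball

theorem diskBall_eq (a : ℂ) (ρ : ℝ) : diskBall a ρ = unitDisk ∩ Metric.ball a ρ := by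
  ext z
  simp [diskBall, dist_eq_norm]

theorem measurableSet_diskBall (a : ℂ) (ρ : ℝ) : MeasurableSet (diskBall a ρ) := by
  rw [diskBall_eq]
  exact measurableSet_unitDisk.inter measurableSet_ball

theorem diskArea_apply {E : Set ℂ} (hE : E ⊆ unitDisk) :
    diskArea E = (ENNReal.ofReal Real.pi)⁻¹ * volume E := by
  rw [diskArea, Measure.smul_apply, Measure.restrict_eq_self _ hE, smul_eq_mul]

theorem volume_eq_pi_mul_diskArea {E : Set ℂ} (hE : E ⊆ unitDisk) :
    volume E = ENNReal.ofReal Real.pi * diskArea E := by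
  rw [diskArea_apply hE, ← mul_assoc, ENNReal.mul_inv_cancel (by simpa using Real.pi_pos)
    ENNReal.ofReal_ne_top, one_mul]

theorem setLIntegral_volume_eq_pi_mul_diskArea {E : Set ℂ} (hE : E ⊆ unitDisk)
    (hEm : MeasurableSet E) (g : ℂ → ℝ≥0∞) :
    ∫⁻ z in E, g z = ENNReal.ofReal Real.pi * ∫⁻ z in E, g z ∂diskArea := by
  rw [diskArea, Measure.restrict_smul, lintegral_smul_measure, Measure.restrict_restrict hEm,
    Set.inter_eq_self_of_subset_left hE, smul_eq_mul, ← mul_assoc,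
    ENNReal.mul_inv_cancel (by simpa using Real.pi_pos) ENNReal.ofReal_ne_top, one_mul]

theorem volume_ball_eq (a : ℂ) {ρ : ℝ} (hρ : 0 ≤ ρ) :
    volume (Metric.ball a ρ) = ENNReal.ofReal Real.pi * ENNReal.ofReal (ρ ^ 2) := by
  rw [Complex.volume_ball, ENNReal.ofReal_pow hρ, mul_comm]
  congr 1
  rw [ENNReal.ofReal, Real.toNNReal_of_nonneg Real.pi_pos.le]
  rfl

theorem diskArea_ball {a : ℂ} {ρ : ℝ} (hρ : 0 ≤ ρ) (h : Metric.ball a ρ ⊆ unitDisk) :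
    diskArea (Metric.ball a ρ) = ENNReal.ofReal (ρ ^ 2) := by
  rw [diskArea_apply h, volume_ball_eq a hρ, ← mul_assoc, ENNReal.inv_mul_cancel
    (by simpa using Real.pi_pos) ENNReal.ofReal_ne_top, one_mul]

theorem diskArea_unitDisk : diskArea unitDisk = 1 := by
  have := diskArea_ball (a := 0) (ρ := 1) zero_le_one subset_rfl
  simpa [unitDisk] using this

theorem diskArea_diskBall_le (a : ℂ) {ρ : ℝ} (hρ : 0 ≤ ρ) :
    diskArea (diskBall a ρ) ≤ ENNReal.ofReal (ρ ^ 2) := by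
  have hsub : diskBall a ρ ⊆ unitDisk := fun z hz => hz.1
  refine le_of_le_of_eq (b := (ENNReal.ofReal Real.pi)⁻¹ * volume (Metric.ball a ρ)) ?_ ?_
  · rw [diskArea_apply hsub, diskBall_eq]
    gcongr
    exact Set.inter_subset_right
  · rw [volume_ball_eq a hρ, ← mul_assoc, ENNReal.inv_mul_cancel
      (by simpa using Real.pi_pos) ENNReal.ofReal_ne_top, one_mul]

theorem norm_lt_one_of_mem {a : ℂ} (ha : a ∈ unitDisk) : ‖a‖ < 1 := by
  simpa [unitDisk] using ha

theorem ball_subset_unitDisk {a : ℂ} {R : ℝ} (ha : a ∈ unitDisk) (hR : R ≤ 1) :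
    Metric.ball a (R * (1 - ‖a‖)) ⊆ unitDisk := by
  have := norm_lt_one_of_mem ha
  refine Metric.ball_subset_ball' ?_
  rw [dist_zero_right]
  nlinarith

theorem diskS_eq_ball {a : ℂ} {R : ℝ} (ha : a ∈ unitDisk) (hR : R ≤ 1) :
    diskS a R = Metric.ball a (R * (1 - ‖a‖)) := by
  have h := ball_subset_unitDisk ha hR
  ext z
  constructor
  · intro hz; simpa [dist_eq_norm] using hz.2
  · intro hz; exact ⟨h hz, by simpa [dist_eq_norm] using hz⟩

theorem diskS_eq_diskBall (a : ℂ) (R : ℝ) : diskS a R = diskBall a (R * (1 - ‖a‖)) := rfl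

theorem diskArea_diskS {a : ℂ} {R : ℝ} (ha : a ∈ unitDisk) (hR0 : 0 ≤ R) (hR : R ≤ 1) :
    diskArea (diskS a R) = ENNReal.ofReal ((R * (1 - ‖a‖)) ^ 2) := by
  have := norm_lt_one_of_mem ha
  rw [diskS_eq_ball ha hR, diskArea_ball (by nlinarith) (ball_subset_unitDisk ha hR)]

/-! ### Muckenhoupt weights -/

/-- The measure `ω dA` on the disk. -/
noncomputable def weightedArea (ω : ℂ → ℝ) : Measure ℂ :=
  diskArea.withDensity fun z => ENNReal.ofReal (ω z)

theorem weightedArea_apply (ω : ℂ → ℝ) {E : Set ℂ} (hE : MeasurableSet E) :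
    weightedArea ω E = ∫⁻ z in E, ENNReal.ofReal (ω z) ∂diskArea :=
  withDensity_apply _ hE

theorem IsA2Weight.isFiniteMeasure_weightedArea {ω : ℂ → ℝ} (hω : IsA2Weight ω) :
    IsFiniteMeasure (weightedArea ω) :=
  isFiniteMeasure_withDensity_ofReal hω.integrable.2

theorem IsA2Weight.aemeasurable_ofReal {ω : ℂ → ℝ} (hω : IsA2Weight ω) :
    AEMeasurable (fun z => ENNReal.ofReal (ω z)) diskArea :=
  hω.integrable.1.aemeasurable.ennreal_ofReal

/-- The `A₂` condition for a single ball, with the denominator cleared. -/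
theorem weightedArea_mul_le {ω : ℂ → ℝ} {K : ℝ≥0∞} (hK : a2Characteristic ω ≤ K) {a : ℂ}
    {ρ : ℝ} (ha : a ∈ unitDisk) (hρ : 0 < ρ) (hρ1 : ρ < 1) :
    weightedArea ω (diskBall a ρ) * ∫⁻ z in diskBall a ρ, (ENNReal.ofReal (ω z))⁻¹ ∂diskArea ≤
      K * diskArea (diskBall a ρ) ^ 2 := by
  rw [weightedArea_apply ω (measurableSet_diskBall a ρ)]
  have h1 : diskArea (diskBall a ρ) ≠ ⊤ :=
    ne_top_of_le_ne_top ENNReal.ofReal_ne_top (diskArea_diskBall_le a hρ.le)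
  have h0 : diskArea (diskBall a ρ) ≠ 0 := by
    have hne : (diskBall a ρ).Nonempty := ⟨a, ha, by simpa using hρ⟩
    have ho : IsOpen (diskBall a ρ) := by
      rw [diskBall_eq]; exact Metric.isOpen_ball.inter Metric.isOpen_ball
    rw [diskArea_apply fun z hz => hz.1]
    exact mul_ne_zero (by simp) (ho.measure_pos volume hne).ne'
  rw [← ENNReal.div_le_iff (pow_ne_zero 2 h0) (ENNReal.pow_ne_top h1)]
  refine le_trans ?_ hK
  exact le_iSup₂_of_le a ha (le_iSup₂_of_le ρ ⟨hρ, hρ1⟩ le_rfl)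

/-- The Cauchy–Schwarz inequality for `g * w ^ (1 / 2)` and `w ^ (-1 / 2)`. -/
theorem sq_lintegral_le_weighted {α : Type*} [MeasurableSpace α] {m : Measure α}
    {g w : α → ℝ≥0∞} (hg : AEMeasurable g m) (hw : AEMeasurable w m)
    (hw0 : ∀ᵐ x ∂m, w x ≠ 0) (hwt : ∀ᵐ x ∂m, w x ≠ ⊤) :
    (∫⁻ x, g x ∂m) ^ 2 ≤ (∫⁻ x, g x ^ 2 * w x ∂m) * ∫⁻ x, (w x)⁻¹ ∂m := by
  have h := ENNReal.lintegral_mul_le_Lp_mul_Lq m Real.HolderConjugate.two_two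
    (hg.mul (hw.pow_const (1 / 2 : ℝ))) (hw.pow_const (-(1 / 2) : ℝ))
  have h1 : ∫⁻ x, ((g * fun x => w x ^ (1 / 2 : ℝ)) * fun x => w x ^ (-(1 / 2) : ℝ)) x ∂m =
      ∫⁻ x, g x ∂m := by
    refine lintegral_congr_ae ?_
    filter_upwards [hw0, hwt] with x h0 ht
    simp only [Pi.mul_apply]
    rw [mul_assoc, ← ENNReal.rpow_add _ _ h0 ht]
    simp
  have h2 : ∀ x, ((g * fun x => w x ^ (1 / 2 : ℝ)) x) ^ (2 : ℝ) = g x ^ 2 * w x := by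
    intro x
    rw [Pi.mul_apply, ENNReal.mul_rpow_of_nonneg _ _ zero_le_two, ← ENNReal.rpow_mul]
    norm_num
  have h3 : ∀ x, (w x ^ (-(1 / 2) : ℝ)) ^ (2 : ℝ) = (w x)⁻¹ := by
    intro x
    rw [← ENNReal.rpow_mul]
    norm_num [ENNReal.rpow_neg_one]
  rw [h1] at h
  simp only [h2, h3] at h
  calc (∫⁻ x, g x ∂m) ^ 2 ≤ _ := pow_le_pow_left' h 2
    _ = _ := by
      rw [mul_pow, ← ENNReal.rpow_natCast, ← ENNReal.rpow_natCast, ← ENNReal.rpow_mul,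
        ← ENNReal.rpow_mul]
      norm_num

theorem IsA2Weight.sq_setLIntegral_le {ω : ℂ → ℝ} (hω : IsA2Weight ω) {g : ℂ → ℝ≥0∞}
    (hg : Measurable g) {E B : Set ℂ} (hE : MeasurableSet E) (hEB : E ⊆ B) :
    (∫⁻ z in E, g z ∂diskArea) ^ 2 ≤ (∫⁻ z in E, g z ^ 2 ∂weightedArea ω) *
      ∫⁻ z in B, (ENNReal.ofReal (ω z))⁻¹ ∂diskArea := by
  have h := sq_lintegral_le_weighted (m := diskArea.restrict E) hg.aemeasurable
    hω.aemeasurable_ofReal.restrict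
    (ae_restrict_of_ae (hω.pos.mono fun z hz => by simpa using hz))
    (Filter.Eventually.of_forall fun z => ENNReal.ofReal_ne_top)
  refine h.trans (mul_le_mul' (le_of_eq ?_) (lintegral_mono_set hEB))
  rw [weightedArea, restrict_withDensity hE, lintegral_withDensity_eq_lintegral_mul₀
    hω.aemeasurable_ofReal.restrict (hg.pow_const 2).aemeasurable]
  simp [mul_comm]

/-- The strong doubling property of `A₂` weights: a subset filling a fixed proportion of the area of
a ball carries a fixed proportion of its weighted area. -/
theorem IsA2Weight.sq_diskArea_mul_weightedArea_le {ω : ℂ → ℝ} (hω : IsA2Weight ω) {K : ℝ≥0∞}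
    (hK : a2Characteristic ω ≤ K) {b : ℂ} {ρ : ℝ} (hb : b ∈ unitDisk) (hρ : 0 < ρ) (hρ1 : ρ < 1)
    {E : Set ℂ} (hE : MeasurableSet E) (hEB : E ⊆ diskBall b ρ) :
    diskArea E ^ 2 * weightedArea ω (diskBall b ρ) ≤
      K * diskArea (diskBall b ρ) ^ 2 * weightedArea ω E := by
  have h := hω.sq_setLIntegral_le (g := fun _ => 1) measurable_const hE hEB
  simp only [setLIntegral_const, one_mul, one_pow] at h
  calc diskArea E ^ 2 * weightedArea ω (diskBall b ρ) ≤ _ := mul_le_mul_left h _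
    _ = weightedArea ω E * (weightedArea ω (diskBall b ρ) *
        ∫⁻ z in diskBall b ρ, (ENNReal.ofReal (ω z))⁻¹ ∂diskArea) := by ring
    _ ≤ weightedArea ω E * (K * diskArea (diskBall b ρ) ^ 2) :=
        mul_le_mul_right (weightedArea_mul_le hK hb hρ hρ1) _
    _ = _ := by ring

/-! ### Geometry of Whitney disks -/

/-- If `z ∈ S(a, R)`, a single ball of comparable area contains `S(a, R)` and all centres `c` with
`z ∈ S(c, R)`. Its radius is kept below `1`, so that the `A₂` condition applies to it. -/
theorem exists_diskBall_superset {R : ℝ} (hR0 : 0 < R) (hR1 : R < 1) {a z : ℂ}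
    (ha : a ∈ unitDisk) (hz : z ∈ diskS a R) :
    ∃ (b : ℂ) (ρ : ℝ), b ∈ unitDisk ∧ 0 < ρ ∧ ρ < 1 ∧ diskS a R ⊆ diskBall b ρ ∧
      {c | c ∈ unitDisk ∧ z ∈ diskS c R} ⊆ diskBall b ρ ∧
      diskArea (diskBall b ρ) ≤
        ENNReal.ofReal ((2 * (1 + R) / (1 - R)) ^ 2) * diskArea (diskS a R) := by
  have ha1 := norm_lt_one_of_mem ha
  have hz1 := norm_lt_one_of_mem hz.1
  have hR1' : 0 < 1 - R := by linarith
  have hup : ∀ c, z ∈ diskS c R → (1 - R) * (1 - ‖c‖) ≤ 1 - ‖z‖ := by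
    intro c hc
    have h1 := hc.2
    have h2 := norm_sub_norm_le z c
    linarith
  have hlow : ∀ c, z ∈ diskS c R → 1 - ‖z‖ ≤ (1 + R) * (1 - ‖c‖) := by
    intro c hc
    have h1 := hc.2
    have h2 := norm_sub_norm_le c z
    rw [norm_sub_rev] at h2
    linarith
  set ρ₀ := 2 * R / (1 - R) * (1 - ‖z‖) with hρ₀
  have hρ₀0 : 0 < ρ₀ := mul_pos (by positivity) (by linarith)
  have harea : ENNReal.ofReal (ρ₀ ^ 2) ≤
      ENNReal.ofReal ((2 * (1 + R) / (1 - R)) ^ 2) * diskArea (diskS a R) := by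
    rw [diskArea_diskS ha hR0.le hR1.le, ← ENNReal.ofReal_mul (by positivity), ← mul_pow]
    refine ENNReal.ofReal_le_ofReal (pow_le_pow_left₀ hρ₀0.le ?_ 2)
    calc ρ₀ ≤ 2 * R / (1 - R) * ((1 + R) * (1 - ‖a‖)) := by
          rw [hρ₀]; gcongr; exact hlow a hz
      _ = _ := by ring
  have hhalf : ∀ c, z ∈ diskS c R → 2 * (R * (1 - ‖c‖)) ≤ ρ₀ := by
    intro c hc
    rw [hρ₀, div_mul_eq_mul_div, le_div_iff₀ hR1']
    nlinarith [hup c hc]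
  rcases lt_or_ge ρ₀ 1 with h | h
  · refine ⟨z, ρ₀, hz.1, hρ₀0, h, ?_, ?_, (diskArea_diskBall_le z hρ₀0.le).trans harea⟩
    · rintro x ⟨hx, hxa⟩
      refine ⟨hx, ?_⟩
      have h1 := hz.2
      have h2 := norm_sub_le_norm_sub_add_norm_sub x a z
      rw [norm_sub_rev a z] at h2
      linarith [hhalf a hz]
    · rintro c ⟨hc, hzc⟩
      refine ⟨hc, ?_⟩
      have h1 := hzc.2
      have h2 := norm_lt_one_of_mem hc
      rw [norm_sub_rev]
      have h3 : 0 < R * (1 - ‖c‖) := mul_pos hR0 (by linarith)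
      linarith [hhalf c hzc]
  · -- Here `z` stays away from the circle, and a large ball about the origin does the job.
    set κ := (1 - R) * (1 - ‖z‖) / (1 + R) with hκ
    have hκ0 : 0 < κ := div_pos (mul_pos hR1' (by linarith)) (by linarith)
    have hκ' : ∀ c, z ∈ diskS c R → κ ≤ (1 - R) * (1 - ‖c‖) := by
      intro c hc
      rw [hκ, div_le_iff₀ (by linarith)]
      nlinarith [hlow c hc]
    have hκ1 : κ ≤ 1 := by
      have := hκ' a hz
      nlinarith [norm_nonneg a]
    refine ⟨0, 1 - κ / 2, by simp [unitDisk], by linarith, by linarith, ?_, ?_, ?_⟩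
    · rintro x ⟨hx, hxa⟩
      refine ⟨hx, ?_⟩
      have h2 := norm_sub_norm_le x a
      rw [sub_zero]
      linarith [hκ' a hz]
    · rintro c ⟨hc, hzc⟩
      refine ⟨hc, ?_⟩
      have h2 := norm_lt_one_of_mem hc
      rw [sub_zero]
      nlinarith [hκ' c hzc]
    · refine le_trans ?_ harea
      calc diskArea (diskBall 0 (1 - κ / 2)) ≤ diskArea unitDisk := measure_mono fun x hx => hx.1
        _ = ENNReal.ofReal 1 := by rw [diskArea_unitDisk, ENNReal.ofReal_one]
        _ ≤ _ := ENNReal.ofReal_le_ofReal (by nlinarith)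

/-- The Schur-type bound behind the averaging estimate: the centres of the Whitney disks through `z`
have total weighted area at most a constant times that of any one of these disks. -/
theorem IsA2Weight.weightedArea_le_of_mem_diskS {ω : ℂ → ℝ} (hω : IsA2Weight ω) {K : ℝ≥0∞}
    (hK : a2Characteristic ω ≤ K) {R : ℝ} (hR0 : 0 < R) (hR1 : R < 1) {a z : ℂ}
    (ha : a ∈ unitDisk) (hz : z ∈ diskS a R) :
    weightedArea ω {c | c ∈ unitDisk ∧ z ∈ diskS c R} ≤
      K * ENNReal.ofReal ((2 * (1 + R) / (1 - R)) ^ 2) ^ 2 * weightedArea ω (diskS a R) := by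
  obtain ⟨b, ρ, hb, hρ, hρ1, hS, hT, harea⟩ := exists_diskBall_superset hR0 hR1 ha hz
  have h := hω.sq_diskArea_mul_weightedArea_le hK hb hρ hρ1 (measurableSet_diskBall a _) hS
  have hpos : 0 < (R * (1 - ‖a‖)) ^ 2 :=
    pow_pos (mul_pos hR0 (by linarith [norm_lt_one_of_mem ha])) 2
  have hσ := diskArea_diskS ha hR0.le hR1.le
  have h0 : diskArea (diskS a R) ^ 2 ≠ 0 := by
    rw [hσ]; exact pow_ne_zero 2 (ENNReal.ofReal_pos.2 hpos).ne'
  have ht : diskArea (diskS a R) ^ 2 ≠ ⊤ := by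
    rw [hσ]; exact ENNReal.pow_ne_top ENNReal.ofReal_ne_top
  refine (ENNReal.mul_le_mul_iff_right h0 ht).1 ?_
  rw [← diskS_eq_diskBall] at h
  calc diskArea (diskS a R) ^ 2 * weightedArea ω {c | c ∈ unitDisk ∧ z ∈ diskS c R}
      ≤ diskArea (diskS a R) ^ 2 * weightedArea ω (diskBall b ρ) := by gcongr
    _ ≤ K * diskArea (diskBall b ρ) ^ 2 * weightedArea ω (diskS a R) := h
    _ ≤ K * (ENNReal.ofReal ((2 * (1 + R) / (1 - R)) ^ 2) * diskArea (diskS a R)) ^ 2 *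
        weightedArea ω (diskS a R) := by gcongr
    _ = _ := by ring

/-! ### The weighted local estimate -/

theorem add_sq_le_four_mul (x y : ℝ≥0∞) : (x + y) ^ 2 ≤ 4 * x ^ 2 + 4 * y ^ 2 := by
  have key : ∀ x y : ℝ≥0∞, x ≤ y → (x + y) ^ 2 ≤ 4 * x ^ 2 + 4 * y ^ 2 := by
    intro x y h
    calc (x + y) ^ 2 ≤ (y + y) ^ 2 := by gcongr
      _ = 4 * y ^ 2 := by ring
      _ ≤ _ := le_add_self
  rcases le_total x y with h | h
  · exact key x y h
  · rw [add_comm x, add_comm (4 * x ^ 2)]; exact key y x h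

open InnerProductSpace in
/-- The local estimate: at the centre of a Whitney disk, `‖f‖²` is controlled by a small multiple of
its weighted mean over the disk and a multiple of its weighted mean over a part of the disk. -/
theorem exists_sq_enorm_mul_weightedArea_le {r R δ ε : ℝ} (hr : 0 < r) (hrR : r < R) (hR : R < 1)
    (hδ : 0 < δ) (hε : 0 < ε) (K : ℝ≥0) :
    ∃ C : ℝ, 0 ≤ C ∧ ∀ ω : ℂ → ℝ, IsA2Weight ω → a2Characteristic ω ≤ K → ∀ G : Set ℂ,
      MeasurableSet G → ∀ a ∈ unitDisk,
      ENNReal.ofReal δ * diskArea (diskS a r) ≤ diskArea (G ∩ diskS a r) →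
      ∀ f : ℂ → ℂ, HarmonicOnNhd f unitDisk →
      ‖f a‖ₑ ^ 2 * weightedArea ω (diskS a R) ≤
        ENNReal.ofReal ε * (∫⁻ z in diskS a R, ‖f z‖ₑ ^ 2 ∂weightedArea ω) +
          ENNReal.ofReal C * ∫⁻ z in diskS a R ∩ G, ‖f z‖ₑ ^ 2 ∂weightedArea ω := by
  classical
  have hR0 : 0 < R := hr.trans hrR
  -- Squaring, Cauchy–Schwarz and the `A₂` condition turn `ε₁` into `4 * π ^ 2 * K * ε₁ ^ 2 ≤ ε`.
  set ε₁ : ℝ := Real.sqrt (ε / (4 * Real.pi ^ 2 * (K + 1))) with hε₁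
  have hε₁0 : 0 < ε₁ := Real.sqrt_pos.2 (by positivity)
  obtain ⟨C, hC, hmain⟩ := exists_enorm_center_le_lintegral (r := r / R)
    (δ := Real.pi * δ * (r / R) ^ 2) (ε := ε₁) (by positivity) ((div_lt_one hR0).2 hrR)
    (by positivity) hε₁0
  refine ⟨4 * K * (C * Real.pi) ^ 2, by positivity, ?_⟩
  intro ω hω hK G hG a ha hGa f hf
  have ha1 := norm_lt_one_of_mem ha
  have hS := diskS_eq_ball ha hR.le
  have hSsub : diskS a R ⊆ unitDisk := fun z hz => hz.1
  have hSm : MeasurableSet (diskS a R) := measurableSet_diskBall a _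
  have hsm : MeasurableSet (diskS a r) := measurableSet_diskBall a _
  have hss : diskS a r ⊆ diskS a R := fun z hz => ⟨hz.1, hz.2.trans (by gcongr)⟩
  have hρ : 0 < R * (1 - ‖a‖) := mul_pos hR0 (by linarith)
  set E := G ∩ diskS a r with hE
  have hEm : MeasurableSet E := hG.inter hsm
  have hES : E ⊆ diskS a R := Set.inter_subset_right.trans hss
  have hES' : E ⊆ diskS a R ∩ G := fun z hz => ⟨hES hz, hz.1⟩
  have hloc := hmain f a (R * (1 - ‖a‖)) E hρ (hf.mono (ball_subset_unitDisk ha hR.le)) hEm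
    (by
      refine Set.inter_subset_right.trans ?_
      rw [diskS_eq_ball ha (hrR.trans hR).le]
      refine Metric.ball_subset_ball (le_of_eq ?_)
      field_simp)
    (by
      rw [volume_eq_pi_mul_diskArea (hES.trans hSsub)]
      refine le_trans (le_of_eq ?_) (mul_le_mul_right hGa _)
      rw [diskArea_diskS ha hr.le (hrR.trans hR).le, ← ENNReal.ofReal_mul hδ.le,
        ← ENNReal.ofReal_mul Real.pi_pos.le]
      congr 1; field_simp)
  rw [← diskArea_diskS ha hR0.le hR.le, ← hS, setLIntegral_volume_eq_pi_mul_diskArea hSsub hSm,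
    setLIntegral_volume_eq_pi_mul_diskArea (hES.trans hSsub) hEm] at hloc
  set g : ℂ → ℝ≥0∞ := unitDisk.indicator fun z => ‖f z‖ₑ with hg
  have hgm : Measurable g := by
    rw [hg, ← Set.piecewise_eq_indicator]
    exact ContinuousOn.measurable_piecewise hf.continuousOn.enorm continuousOn_const
      measurableSet_unitDisk
  have hgf : ∀ z ∈ unitDisk, g z = ‖f z‖ₑ := fun z hz => Set.indicator_of_mem hz _
  have hCS : ∀ F ⊆ diskS a R, MeasurableSet F → (∫⁻ z in F, ‖f z‖ₑ ∂diskArea) ^ 2 ≤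
      (∫⁻ z in F, ‖f z‖ₑ ^ 2 ∂weightedArea ω) *
        ∫⁻ z in diskS a R, (ENNReal.ofReal (ω z))⁻¹ ∂diskArea := by
    intro F hF hFm
    have h := hω.sq_setLIntegral_le hgm hFm hF
    rwa [setLIntegral_congr_fun hFm fun z hz => hgf z (hSsub (hF hz)),
      setLIntegral_congr_fun (μ := weightedArea ω) (g := fun z => ‖f z‖ₑ ^ 2) hFm
        fun z hz => by simp only [hgf z (hSsub (hF hz))]] at h
  have hA2 := weightedArea_mul_le hK ha hρ (by nlinarith [norm_nonneg a])
  rw [← diskS_eq_diskBall] at hA2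
  have hσ := diskArea_diskS ha hR0.le hR.le
  have hpos : 0 < (R * (1 - ‖a‖)) ^ 2 := pow_pos hρ 2
  set σ := diskArea (diskS a R) with hσ_def
  have h0 : σ ^ 2 ≠ 0 := by
    rw [hσ]; exact pow_ne_zero 2 (ENNReal.ofReal_pos.2 hpos).ne'
  have ht : σ ^ 2 ≠ ⊤ := by
    rw [hσ]; exact ENNReal.pow_ne_top ENNReal.ofReal_ne_top
  set X := ∫⁻ z in diskS a R, ‖f z‖ₑ ^ 2 ∂weightedArea ω
  set Y := ∫⁻ z in E, ‖f z‖ₑ ^ 2 ∂weightedArea ω with hY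
  set ν := ∫⁻ z in diskS a R, (ENNReal.ofReal (ω z))⁻¹ ∂diskArea
  set μ := weightedArea ω (diskS a R)
  set α := ENNReal.ofReal ε₁ * ENNReal.ofReal Real.pi with hα
  set β := ENNReal.ofReal C * ENNReal.ofReal Real.pi with hβ
  have hαK : 4 * α ^ 2 * K ≤ ENNReal.ofReal ε := by
    rw [hα, ← ENNReal.ofReal_mul hε₁0.le, ← ENNReal.ofReal_pow (by positivity),
      ← ENNReal.ofReal_coe_nnreal, show (4 : ℝ≥0∞) = ENNReal.ofReal 4 by simp,
      ← ENNReal.ofReal_mul (by positivity), ← ENNReal.ofReal_mul (by positivity)]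
    refine ENNReal.ofReal_le_ofReal ?_
    rw [mul_pow, hε₁, Real.sq_sqrt (by positivity)]
    have h1 : (K : ℝ) / (K + 1) ≤ 1 := (div_le_one (by positivity)).2 (by linarith)
    calc _ = ε * ((K : ℝ) / (K + 1)) := by field_simp
      _ ≤ ε := mul_le_of_le_one_right hε.le h1
  have hβK : 4 * β ^ 2 * K = ENNReal.ofReal (4 * K * (C * Real.pi) ^ 2) := by
    rw [hβ, ← ENNReal.ofReal_mul hC, ← ENNReal.ofReal_pow (by positivity),
      ← ENNReal.ofReal_coe_nnreal, show (4 : ℝ≥0∞) = ENNReal.ofReal 4 by simp,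
      ← ENNReal.ofReal_mul (by positivity), ← ENNReal.ofReal_mul (by positivity)]
    congr 1; ring
  have hfin : ‖f a‖ₑ ^ 2 * μ ≤ 4 * α ^ 2 * K * X + 4 * β ^ 2 * K * Y := by
    refine (ENNReal.mul_le_mul_iff_right h0 ht).1 ?_
    calc σ ^ 2 * (‖f a‖ₑ ^ 2 * μ) = (σ * ‖f a‖ₑ) ^ 2 * μ := by ring
      _ ≤ (α * (∫⁻ z in diskS a R, ‖f z‖ₑ ∂diskArea) +
            β * ∫⁻ z in E, ‖f z‖ₑ ∂diskArea) ^ 2 * μ := by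
          gcongr
          rw [hα, hβ, mul_assoc, mul_assoc]
          exact hloc
      _ ≤ (4 * (α * (∫⁻ z in diskS a R, ‖f z‖ₑ ∂diskArea)) ^ 2 +
            4 * (β * ∫⁻ z in E, ‖f z‖ₑ ∂diskArea) ^ 2) * μ := by
          gcongr
          exact add_sq_le_four_mul _ _
      _ = (4 * α ^ 2 * (∫⁻ z in diskS a R, ‖f z‖ₑ ∂diskArea) ^ 2 +
            4 * β ^ 2 * (∫⁻ z in E, ‖f z‖ₑ ∂diskArea) ^ 2) * μ := by ring
      _ ≤ (4 * α ^ 2 * (X * ν) + 4 * β ^ 2 * (Y * ν)) * μ := by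
          gcongr
          · exact hCS _ subset_rfl hSm
          · exact hCS _ hES hEm
      _ = (4 * α ^ 2 * X + 4 * β ^ 2 * Y) * (μ * ν) := by ring
      _ ≤ (4 * α ^ 2 * X + 4 * β ^ 2 * Y) * (K * σ ^ 2) := by gcongr
      _ = _ := by ring
  refine hfin.trans (add_le_add (by gcongr) ?_)
  rw [hβK, hY]
  gcongr

/-! ### Averages over Whitney disks -/

theorem IsA2Weight.weightedArea_diskS_ne_zero {ω : ℂ → ℝ} (hω : IsA2Weight ω) {a : ℂ} {R : ℝ}
    (ha : a ∈ unitDisk) (hR0 : 0 < R) (hR1 : R ≤ 1) : weightedArea ω (diskS a R) ≠ 0 := by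
  have hpos : 0 < (R * (1 - ‖a‖)) ^ 2 :=
    pow_pos (mul_pos hR0 (by linarith [norm_lt_one_of_mem ha])) 2
  have h0 : diskArea (diskS a R) ≠ 0 := by
    rw [diskArea_diskS ha hR0.le hR1]; exact (ENNReal.ofReal_pos.2 hpos).ne'
  intro h
  rw [weightedArea, withDensity_apply_eq_zero' hω.aemeasurable_ofReal] at h
  refine h0 (measure_mono_null (t := {z | ENNReal.ofReal (ω z) ≠ 0} ∩ diskS a R ∪ {z | ¬ 0 < ω z})
    (fun z hz => ?_) (measure_union_null h hω.pos))
  by_cases hz0 : 0 < ω z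
  · exact Or.inl ⟨(ENNReal.ofReal_pos.2 hz0).ne', hz⟩
  · exact Or.inr hz0

/-- Averaging over Whitney disks is bounded on `L¹`. By Tonelli's theorem this reduces to
`IsA2Weight.weightedArea_le_of_mem_diskS`. The function is integrated against an arbitrary
measure `m`, while the averages are normalized and integrated with respect to `ω dA`. -/
theorem IsA2Weight.lintegral_average_diskS_le {ω : ℂ → ℝ} (hω : IsA2Weight ω) {K : ℝ≥0∞}
    (hK : a2Characteristic ω ≤ K) {R : ℝ} (hR0 : 0 < R) (hR1 : R < 1) {N : ℝ≥0∞}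
    (hN : K * ENNReal.ofReal ((2 * (1 + R) / (1 - R)) ^ 2) ^ 2 ≤ N) (hN0 : N ≠ 0) (hNt : N ≠ ⊤)
    (m : Measure ℂ) [SFinite m] {h : ℂ → ℝ≥0∞} (hh : Measurable h) :
    ∫⁻ a in unitDisk, (weightedArea ω (diskS a R))⁻¹ * ∫⁻ z in diskS a R, h z ∂m
      ∂weightedArea ω ≤ N * ∫⁻ z, h z ∂m := by
  classical
  have := hω.isFiniteMeasure_weightedArea
  set W : Set (ℂ × ℂ) := {p | p.1 ∈ unitDisk ∧ p.2 ∈ diskS p.1 R} with hW_def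
  have hW : MeasurableSet W := by
    have h1 : MeasurableSet {p : ℂ × ℂ | p.1 ∈ unitDisk} := measurable_fst measurableSet_unitDisk
    have h2 : MeasurableSet {p : ℂ × ℂ | p.2 ∈ unitDisk} := measurable_snd measurableSet_unitDisk
    have h3 : MeasurableSet {p : ℂ × ℂ | ‖p.2 - p.1‖ < R * (1 - ‖p.1‖)} :=
      measurableSet_lt (by fun_prop) (by fun_prop)
    exact h1.inter (h2.inter h3)
  have hsec : ∀ a ∈ unitDisk, Prod.mk a ⁻¹' W = diskS a R := by
    intro a ha
    ext z
    simp [hW_def, ha]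
  set V : ℂ → ℝ≥0∞ := fun a => weightedArea ω (Prod.mk a ⁻¹' W) with hV_def
  have hV : Measurable V := measurable_measure_prodMk_left hW
  have hker : Measurable fun p : ℂ × ℂ => (V p.1)⁻¹ * W.indicator (fun p => h p.2) p :=
    (hV.comp measurable_fst).inv.mul ((hh.comp measurable_snd).indicator hW)
  calc ∫⁻ a in unitDisk, (weightedArea ω (diskS a R))⁻¹ * ∫⁻ z in diskS a R, h z ∂m
        ∂weightedArea ω
      = ∫⁻ a in unitDisk, ∫⁻ z, (V a)⁻¹ * W.indicator (fun p => h p.2) (a, z) ∂m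
          ∂weightedArea ω := by
        refine setLIntegral_congr_fun measurableSet_unitDisk fun a ha => ?_
        have h1 : MeasurableSet (diskS a R) := measurableSet_diskBall a _
        have h2 : Measurable fun z => W.indicator (fun p => h p.2) (a, z) :=
          ((hh.comp measurable_snd).indicator hW).comp measurable_prodMk_left
        rw [lintegral_const_mul _ h2, hV_def]
        beta_reduce
        rw [hsec a ha, ← lintegral_indicator h1, ← hsec a ha]
        rfl
    _ ≤ ∫⁻ a, ∫⁻ z, (V a)⁻¹ * W.indicator (fun p => h p.2) (a, z) ∂m ∂weightedArea ω :=
        setLIntegral_le_lintegral _ _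
    _ = ∫⁻ z, ∫⁻ a, (V a)⁻¹ * W.indicator (fun p => h p.2) (a, z) ∂weightedArea ω ∂m :=
        lintegral_lintegral_swap hker.aemeasurable
    _ ≤ ∫⁻ z, N * h z ∂m := by
        refine lintegral_mono fun z => ?_
        set T : Set ℂ := {c | c ∈ unitDisk ∧ z ∈ diskS c R} with hT_def
        have hT : MeasurableSet T := measurable_prodMk_right hW
        have hbd : ∀ a, (V a)⁻¹ * W.indicator (fun p => h p.2) (a, z) ≤
            T.indicator (fun _ => N * (weightedArea ω T)⁻¹ * h z) a := by
          intro a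
          by_cases ha : a ∈ T
          · have haW : (a, z) ∈ W := ha
            rw [Set.indicator_of_mem haW, Set.indicator_of_mem ha]
            gcongr
            have h1 : weightedArea ω T ≤ N * V a := by
              rw [hV_def]
              beta_reduce
              rw [hsec a ha.1]
              exact (hω.weightedArea_le_of_mem_diskS hK hR0 hR1 ha.1 ha.2).trans (by gcongr)
            calc (V a)⁻¹ = N * (N * V a)⁻¹ := by
                  rw [ENNReal.mul_inv (Or.inl hN0) (Or.inl hNt), ← mul_assoc,
                    ENNReal.mul_inv_cancel hN0 hNt, one_mul]
              _ ≤ N * (weightedArea ω T)⁻¹ := by gcongr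
          · have haW : (a, z) ∉ W := ha
            rw [Set.indicator_of_notMem haW, mul_zero]
            exact zero_le
        calc _ ≤ ∫⁻ a, T.indicator (fun _ => N * (weightedArea ω T)⁻¹ * h z) a
              ∂weightedArea ω := lintegral_mono hbd
          _ = N * h z * ((weightedArea ω T)⁻¹ * weightedArea ω T) := by
              rw [lintegral_indicator_const hT]; ring
          _ ≤ N * h z * 1 := by gcongr; exact ENNReal.inv_mul_le_one _
          _ = N * h z := mul_one _
    _ = _ := lintegral_const_mul _ hh

/-! ### Dominating sets -/

theorem lintegral_weightedArea_eq {ω : ℂ → ℝ} (hω : IsA2Weight ω) {f : ℂ → ℂ} {E : Set ℂ}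
    (hE : MeasurableSet E)
    (hEs : E ⊆ unitDisk) (hf : ContinuousOn f unitDisk) :
    ∫⁻ z in E, ‖f z‖ₑ ^ 2 ∂weightedArea ω =
      ∫⁻ z in E, ENNReal.ofReal (‖f z‖ ^ 2 * ω z) ∂diskArea := by
  have hfm : AEMeasurable (fun z => ‖f z‖ₑ ^ 2) (diskArea.restrict E) := by
    have h1 : AEMeasurable f ((volume : Measure ℂ).restrict E) := (hf.mono hEs).aemeasurable hE
    rw [diskArea, Measure.restrict_smul, Measure.restrict_restrict hE,
      Set.inter_eq_self_of_subset_left hEs]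
    exact ((h1.smul_measure _).enorm).pow_const 2
  rw [weightedArea, restrict_withDensity hE,
    lintegral_withDensity_eq_lintegral_mul₀ hω.aemeasurable_ofReal.restrict hfm]
  refine lintegral_congr fun z => ?_
  rw [Pi.mul_apply, ENNReal.ofReal_mul (by positivity), ENNReal.ofReal_pow (norm_nonneg _),
    ofReal_norm, mul_comm]

open InnerProductSpace in
/-- The dominating set inequality in `ℝ≥0∞`-valued form. The finiteness hypothesis is what allows
half of the left-hand side to be absorbed. -/
theorem exists_lintegral_unitDisk_le {r δ : ℝ} (hr : 0 < r) (hr1 : r < 1) (hδ : 0 < δ) (K : ℝ≥0) :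
    ∃ C : ℝ, 0 < C ∧ ∀ ω : ℂ → ℝ, IsA2Weight ω → a2Characteristic ω ≤ K → ∀ G ⊆ unitDisk,
      MeasurableSet G →
      (∀ a ∈ unitDisk, ENNReal.ofReal δ * diskArea (diskS a r) ≤ diskArea (G ∩ diskS a r)) →
      ∀ f : ℂ → ℂ, HarmonicOnNhd f unitDisk →
      ∫⁻ z in unitDisk, ‖f z‖ₑ ^ 2 ∂weightedArea ω ≠ ⊤ →
      ∫⁻ z in unitDisk, ‖f z‖ₑ ^ 2 ∂weightedArea ω ≤
        ENNReal.ofReal C * ∫⁻ z in G, ‖f z‖ₑ ^ 2 ∂weightedArea ω := by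
  classical
  set R : ℝ := (1 + r) / 2 with hR
  have hrR : r < R := by rw [hR]; linarith
  have hR1 : R < 1 := by rw [hR]; linarith
  have hR0 : 0 < R := hr.trans hrR
  set N : ℝ := K * ((2 * (1 + R) / (1 - R)) ^ 2) ^ 2 + 1 with hN
  have hN0 : 0 < N := by positivity
  obtain ⟨C, hC, hmain⟩ := exists_sq_enorm_mul_weightedArea_le (ε := 1 / (2 * N)) hr hrR hR1 hδ
    (by positivity) K
  refine ⟨2 * N * C + 1, by positivity, ?_⟩
  intro ω hω hK G hGs hG hGa f hf hfin
  have := hω.isFiniteMeasure_weightedArea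
  set h : ℂ → ℝ≥0∞ := unitDisk.indicator fun z => ‖f z‖ₑ ^ 2 with hh_def
  have hh : Measurable h := by
    rw [hh_def, ← Set.piecewise_eq_indicator]
    exact ContinuousOn.measurable_piecewise
      ((ENNReal.continuous_pow 2).comp_continuousOn hf.continuousOn.enorm) continuousOn_const
      measurableSet_unitDisk
  have hhf : ∀ z ∈ unitDisk, h z = ‖f z‖ₑ ^ 2 := fun z hz => Set.indicator_of_mem hz _
  have hNK : (K : ℝ≥0∞) * ENNReal.ofReal ((2 * (1 + R) / (1 - R)) ^ 2) ^ 2 ≤ ENNReal.ofReal N := by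
    rw [← ENNReal.ofReal_pow (by positivity), ← ENNReal.ofReal_coe_nnreal,
      ← ENNReal.ofReal_mul (by positivity)]
    exact ENNReal.ofReal_le_ofReal (by rw [hN]; linarith)
  have hN0' : ENNReal.ofReal N ≠ 0 := (ENNReal.ofReal_pos.2 hN0).ne'
  set μ := weightedArea ω with hμ
  set I := ∫⁻ z in unitDisk, ‖f z‖ₑ ^ 2 ∂μ with hI
  set J := ∫⁻ z in G, ‖f z‖ₑ ^ 2 ∂μ with hJ
  have hIle : ∫⁻ z, h z ∂μ = I := lintegral_indicator measurableSet_unitDisk _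
  have hJle : ∫⁻ z, h z ∂μ.restrict G = J := setLIntegral_congr_fun hG fun z hz => hhf z (hGs hz)
  -- Both averages in the local estimate are averages of `h` against one auxiliary measure.
  set m : Measure ℂ := ENNReal.ofReal (1 / (2 * N)) • μ + ENNReal.ofReal C • μ.restrict G with hm
  have hav := hω.lintegral_average_diskS_le hK hR0 hR1 hNK hN0' ENNReal.ofReal_ne_top m hh
  have hmI : ∫⁻ z, h z ∂m = ENNReal.ofReal (1 / (2 * N)) * I + ENNReal.ofReal C * J := by
    rw [hm, lintegral_add_measure, lintegral_smul_measure, lintegral_smul_measure, hIle, hJle,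
      smul_eq_mul, smul_eq_mul]
  have hpt : ∀ a ∈ unitDisk, ‖f a‖ₑ ^ 2 ≤ (μ (diskS a R))⁻¹ * ∫⁻ z in diskS a R, h z ∂m := by
    intro a ha
    have hSm : MeasurableSet (diskS a R) := measurableSet_diskBall a _
    have h1 := hmain ω hω hK G hG a ha (hGa a ha) f hf
    have h2 : ∫⁻ z in diskS a R, h z ∂μ = ∫⁻ z in diskS a R, ‖f z‖ₑ ^ 2 ∂μ :=
      setLIntegral_congr_fun hSm fun z hz => hhf z hz.1
    have h3 : ∫⁻ z in diskS a R, h z ∂μ.restrict G = ∫⁻ z in diskS a R ∩ G, ‖f z‖ₑ ^ 2 ∂μ := by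
      rw [Measure.restrict_restrict hSm]
      exact setLIntegral_congr_fun (hSm.inter hG) fun z hz => hhf z hz.1.1
    rw [hm, Measure.restrict_add, Measure.restrict_smul, Measure.restrict_smul,
      lintegral_add_measure, lintegral_smul_measure, lintegral_smul_measure, h2, h3,
      smul_eq_mul, smul_eq_mul]
    have h4 := hω.weightedArea_diskS_ne_zero ha hR0 hR1.le
    have h5 : μ (diskS a R) ≠ ⊤ := measure_ne_top _ _
    rw [← ENNReal.le_div_iff_mul_le (Or.inl h4) (Or.inl h5)] at h1
    refine h1.trans_eq ?_
    rw [ENNReal.div_eq_inv_mul]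
  have hself : I ≤ I / 2 + ENNReal.ofReal (N * C) * J := by
    calc I ≤ ∫⁻ a in unitDisk, (μ (diskS a R))⁻¹ * ∫⁻ z in diskS a R, h z ∂m ∂μ :=
          setLIntegral_mono_ae' measurableSet_unitDisk (Filter.Eventually.of_forall hpt)
      _ ≤ ENNReal.ofReal N * (ENNReal.ofReal (1 / (2 * N)) * I + ENNReal.ofReal C * J) :=
          hav.trans_eq (by rw [hmI])
      _ = I / 2 + ENNReal.ofReal (N * C) * J := by
          rw [mul_add, ← mul_assoc, ← mul_assoc, ← ENNReal.ofReal_mul hN0.le,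
            ← ENNReal.ofReal_mul hN0.le, show N * (1 / (2 * N)) = (2 : ℝ)⁻¹ by field_simp,
            ENNReal.ofReal_inv_of_pos two_pos, ENNReal.ofReal_ofNat, ENNReal.div_eq_inv_mul]
  have hhalf : I / 2 ≤ ENNReal.ofReal (N * C) * J := by
    have h1 : I / 2 ≠ ⊤ := ENNReal.div_ne_top hfin two_ne_zero
    refine (ENNReal.add_le_add_iff_left h1).1 ?_
    rwa [ENNReal.add_halves]
  calc I = 2 * (I / 2) := (ENNReal.mul_div_cancel two_ne_zero ENNReal.ofNat_ne_top).symm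
    _ ≤ 2 * (ENNReal.ofReal (N * C) * J) := by gcongr
    _ = ENNReal.ofReal (2 * N * C) * J := by
        rw [← mul_assoc, mul_assoc 2 N C, ENNReal.ofReal_mul zero_le_two, ENNReal.ofReal_ofNat]
    _ ≤ _ := by gcongr; linarith

theorem mainTheorem9 (r δ : ℝ) (hr : 0 < r ∧ r < 1) (hδ : 0 < δ ∧ δ < 1) (K : ℝ≥0) :
    ∃ C : ℝ, 0 < C ∧
      ∀ ω : ℂ → ℝ, IsA2Weight ω → a2Characteristic ω ≤ (K : ℝ≥0∞) →
      ∀ G : Set ℂ, G ⊆ unitDisk → NullMeasurableSet G (volume : Measure ℂ) →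
        (∀ a ∈ unitDisk,
          ENNReal.ofReal δ * diskArea (diskS a r) ≤ diskArea (G ∩ diskS a r)) →
        ∀ f ∈ harmonicBergman ω,
          ∫ z in unitDisk, ‖f z‖ ^ 2 * ω z ∂diskArea ≤
            C * ∫ z in G, ‖f z‖ ^ 2 * ω z ∂diskArea := by
  obtain ⟨C, hC, hmain⟩ := exists_lintegral_unitDisk_le hr.1 hr.2 hδ.1 K
  refine ⟨C, hC, ?_⟩
  intro ω hω hK G hGs hG hGa f hf
  obtain ⟨G', hG's, hG'm, hG'ae⟩ := hG.exists_measurable_subset_ae_eq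
  have hae : G' =ᵐ[diskArea] G :=
    (Measure.smul_absolutelyContinuous.trans Measure.restrict_le_self.absolutelyContinuous) hG'ae
  have hnonneg : 0 ≤ᵐ[diskArea] fun z => ‖f z‖ ^ 2 * ω z := by
    filter_upwards [hω.pos] with z hz
    positivity
  have hconv : ∀ E : Set ℂ, ∫ z in E, ‖f z‖ ^ 2 * ω z ∂diskArea =
      (∫⁻ z in E, ENNReal.ofReal (‖f z‖ ^ 2 * ω z) ∂diskArea).toReal := fun E =>
    integral_eq_lintegral_of_nonneg_ae (ae_restrict_of_ae hnonneg) hf.2.1.restrict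
  have hfinite : ∀ E : Set ℂ, ∫⁻ z in E, ENNReal.ofReal (‖f z‖ ^ 2 * ω z) ∂diskArea ≠ ⊤ := by
    intro E
    have h1 := (hf.2.restrict (s := E)).lintegral_lt_top
    exact h1.ne
  have hcont : ContinuousOn f unitDisk := InnerProductSpace.HarmonicOnNhd.continuousOn hf.1
  have h := hmain ω hω hK G' (hG's.trans hGs) hG'm (fun a ha => by
    rw [measure_congr (hae.inter (Filter.EventuallyEq.refl _ (diskS a r)))]
    exact hGa a ha) f hf.1 (by
      rw [lintegral_weightedArea_eq hω measurableSet_unitDisk subset_rfl hcont]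
      exact hfinite _)
  rw [lintegral_weightedArea_eq hω measurableSet_unitDisk subset_rfl hcont,
    lintegral_weightedArea_eq hω hG'm (hG's.trans hGs) hcont] at h
  rw [← setIntegral_congr_set hae, hconv, hconv]
  have h2 := ENNReal.toReal_mono (ENNReal.mul_ne_top ENNReal.ofReal_ne_top (hfinite _)) h
  rwa [ENNReal.toReal_mul, ENNReal.toReal_ofReal hC.le] at h2
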